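/- Let $\mathbb S=\{I\in\mathbb H : I^2=-1\}$ be the sphere of imaginary units of the quaternions, and for $x\in\mathbb H\setminus\mathbb R$ put $\mathcal J(x)=\operatorname{Im}(x)/|\operatorname{Im}(x)|$. For $J\in\mathbb S$ define $\ell^{\pm,J}:\mathbb H\setminus\mathbb R\to\mathbb H$ by $$\ell^{+,J}(x)=\frac{1-\mathcal J(x)J}{2},\qquad \ell^{-,J}(x)=\frac{1+\mathcal J(x)J}{2}.$$ For $q\in\mathbb H\setminus\mathbb R$ let $\Delta_q(x)=x^2-x(q+q^c)+qq^c$, where $q^c$ is the conjugate of $q$, and for $R>0$ let $U(q,R)=\{x\in\mathbb H: |\Delta_q(x)|<R^2\}$ (a Cassini ball). If $f$ is a slice regular function on a circularization $\Omega_D=\{\alpha+I\beta : \alpha+i\beta\in D,\ I\in\mathbb S\}$ of an open set $D=\overline D\subset\mathbb C$ (that is, $f(\alpha+I\beta)=F_0(\alpha+i\beta)+I\,F_1(\alpha+i\beta)$ for $\alpha+i\beta\in D$, $I\in\mathbb S$, with $F_0+\sqrt{-1}F_1:D\to\mathbb H\otimes\mathbb C$ holomorphic, $F_0(\bar z)=F_0(z)$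 and $F_1(\bar z)=-F_1(z)$) and $q\in\Omega_D\setminus\mathbb R$, the spherical coefficients of $f$ at $q$ are the $s_n\in\mathbb H$ such that $$f(x)=\sum_{n\ge 0}\Delta_q(x)^n\,[\,s_{2n}+(x-q)s_{2n+1}\,]$$ for all $x$ in some Cassini ball $U(q,R)\subset\Omega_D$, $R>0$. **Corollary.** Let $J\in\mathbb S$ and $q=\alpha+I\beta\in\mathbb H\setminus\mathbb R$ with $I\in\mathbb S$, $\alpha\in\mathbb R$ and $\beta>0$. Then $\ell^{+,J}$ and $\ell^{-,J}$ are slice regular on $\mathbb H\setminus\mathbb R$, and their spherical coefficients $s_n^{\pm}$ at $q$ exist, are unique and are given by $$s_0^{\pm}=\frac{1\mp IJ}{2},\qquad s_{2k}^{\pm}=\mp\frac{1}{k!}\frac{(2k-1)!!}{2^{k+1}}\frac{1}{\beta^{2k}}\,IJ\quad(k\ge 1),\qquad s_{2k+1}^{\pm}=\mp\frac{1}{k!}\frac{(2k-1)!!}{2^{k+1}}\frac{1}{\beta^{2k+1}}\,J\quad(k\ge 0),$$ with the convention $(-1)!!=1$. Moreover, the resulting expansions hold on every Cassini ball $U(q,R)\subset\mathbb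 H\setminus\mathbb R$, $R>0$. -/

import Mathlib

open scoped Quaternion Nat

namespace SliceReg

/-- The sphere `𝕊` of imaginary units of the quaternions. -/
def imUnits : Set ℍ[ℝ] := {x | x ^ 2 = -1}

/-- The set `ℍ ∖ ℝ` of non-real quaternions. -/
def nonReal : Set ℍ[ℝ] := {x | x ∉ Set.range (fun r : ℝ => (r : ℍ[ℝ]))}

/-- The circularization `Ω_D = {α + Iβ : α + iβ ∈ D, I ∈ 𝕊}` of `D ⊆ ℂ`. -/
def circularization (D : Set ℂ) : Set ℍ[ℝ] :=
  {x | ∃ z ∈ D, ∃ I ∈ imUnits, x = (z.re : ℍ[ℝ]) + I * (z.im : ℍ[ℝ])}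

/-- `F = F₀ + √-1 F₁ : D → ℍ ⊗ ℂ` is a stem function: `F (conj z) = conj (F z)` on `D`, where
`x + √-1 y ∈ ℍ ⊗ ℂ` is the pair `(x, y)` and its conjugate is `x - √-1 y`. -/
def IsStem (D : Set ℂ) (F₀ F₁ : ℂ → ℍ[ℝ]) : Prop :=
  ∀ z ∈ D, F₀ (starRingEnd ℂ z) = F₀ z ∧ F₁ (starRingEnd ℂ z) = -F₁ z

/-- `F = F₀ + √-1 F₁` induces the (left) slice function `f` on `Ω_D`:
`f (α + Iβ) = F₀ (α + iβ) + I F₁ (α + iβ)`. -/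
def Induces (D : Set ℂ) (F₀ F₁ : ℂ → ℍ[ℝ]) (f : ℍ[ℝ] → ℍ[ℝ]) : Prop :=
  ∀ z ∈ D, ∀ I ∈ imUnits, f ((z.re : ℍ[ℝ]) + I * (z.im : ℍ[ℝ])) = F₀ z + I * F₁ z

/-- `F = F₀ + √-1 F₁ : D → ℍ ⊗ ℂ` is holomorphic for the complex structure of `ℍ ⊗ ℂ` given by
multiplication by `√-1`: it is real differentiable and `∂F/∂β = √-1 ∂F/∂α`, i.e. the
Cauchy-Riemann equations `∂F₀/∂α = ∂F₁/∂β`, `∂F₀/∂β = -∂F₁/∂α` hold. -/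
def IsHolomorphicStem (D : Set ℂ) (F₀ F₁ : ℂ → ℍ[ℝ]) : Prop :=
  ∀ z ∈ D, DifferentiableAt ℝ F₀ z ∧ DifferentiableAt ℝ F₁ z ∧
    fderiv ℝ F₀ z 1 = fderiv ℝ F₁ z Complex.I ∧
    fderiv ℝ F₀ z Complex.I = -fderiv ℝ F₁ z 1

/-- `f` is (left) slice regular on `Ω`: here `Ω = Ω_D` for an open `D ⊆ ℂ` with `conj D = D`, and
`f` is induced on `Ω_D` by a holomorphic stem function on `D`. Only the values of `f` on `Ω`
matter. -/
def IsSliceRegularOn (Ω : Set ℍ[ℝ]) (f : ℍ[ℝ] → ℍ[ℝ]) : Prop :=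
  ∃ D : Set ℂ, IsOpen D ∧ (∀ z, z ∈ D ↔ starRingEnd ℂ z ∈ D) ∧ Ω = circularization D ∧
    ∃ F₀ F₁ : ℂ → ℍ[ℝ], IsStem D F₀ F₁ ∧ IsHolomorphicStem D F₀ F₁ ∧ Induces D F₀ F₁ f

/-- The characteristic polynomial `Δ_q(x) = x² - x (q + qᶜ) + q qᶜ`. -/
noncomputable def charPoly (q x : ℍ[ℝ]) : ℍ[ℝ] := x ^ 2 - x * (q + star q) + q * star q

/-- The Cassini ball `U(q, R) = {x : |Δ_q(x)| < R²}`. -/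
def cassiniBall (q : ℍ[ℝ]) (R : ℝ) : Set ℍ[ℝ] := {x | ‖charPoly q x‖ < R ^ 2}

/-- `f(x) = ∑ₙ Δ_q(x)ⁿ [s₂ₙ + (x - q) s₂ₙ₊₁]` for all `x ∈ U`. -/
def HasSphericalExpansionOn (U : Set ℍ[ℝ]) (f : ℍ[ℝ] → ℍ[ℝ]) (q : ℍ[ℝ]) (s : ℕ → ℍ[ℝ]) : Prop :=
  ∀ x ∈ U, HasSum (fun n : ℕ => charPoly q x ^ n * (s (2 * n) + (x - q) * s (2 * n + 1))) (f x)

/-- `s` is the sequence of spherical coefficients at the non-real point `q ∈ Ω` of the slice regular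
function `f : Ω → ℍ`: the spherical expansion with coefficients `s` represents `f` on some Cassini
ball around `q` contained in `Ω`. -/
def IsSphericalCoeffs (Ω : Set ℍ[ℝ]) (f : ℍ[ℝ] → ℍ[ℝ]) (q : ℍ[ℝ]) (s : ℕ → ℍ[ℝ]) : Prop :=
  IsSliceRegularOn Ω f ∧ q ∈ Ω ∩ nonReal ∧
    ∃ R : ℝ, 0 < R ∧ cassiniBall q R ⊆ Ω ∧ HasSphericalExpansionOn (cassiniBall q R) f q s

/-- The function `𝒥(x) = Im x / |Im x|`, considered on `ℍ ∖ ℝ` only. -/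
noncomputable def unitIm (x : ℍ[ℝ]) : ℍ[ℝ] := ‖x.im‖⁻¹ • x.im

/-- The idempotent function `ℓ^{+,J}(x) = (1 - 𝒥(x) J) / 2` on `ℍ ∖ ℝ`. -/
noncomputable def ellPlus (J x : ℍ[ℝ]) : ℍ[ℝ] := (1 / 2 : ℝ) • (1 - unitIm x * J)

/-- The idempotent function `ℓ^{-,J}(x) = (1 + 𝒥(x) J) / 2` on `ℍ ∖ ℝ`. -/
noncomputable def ellMinus (J x : ℍ[ℝ]) : ℍ[ℝ] := (1 / 2 : ℝ) • (1 + unitIm x * J)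

/-- The number `(1 / k!) (2k-1)!! / 2^(k+1)`, with `(-1)!! = 1`. -/
noncomputable def coeffConst (k : ℕ) : ℝ :=
  1 / (k ! : ℝ) * (((2 * k - 1)‼ : ℕ) : ℝ) / 2 ^ (k + 1)

end SliceReg

namespace SliceReg

open Filter Topology

/-! Put `K = 𝒥(x)`. Since `Δ_q(x) = (x - α)² + β²` has real coefficients, everything happens in the
slice `ℝ + Kℝ`, a copy of ℂ in which `x` lies in the upper half plane. There `w = -K(x - α)/β` has
positive real part and `w² = 1 - Δ_q(x)/β²`, so `K = w⁻¹(x - α)/β`, and the binomial series of `(1 -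
u)^(-1/2)` expands `K` in powers of `Δ_q(x)` when `|Δ_q(x)| < β²` (`hasSum_unit`). Substituting `x -
α = Iβ + (x - q)` gives the coefficients (`hasSphericalExpansionOn_ellPlus`).

Since `Δ_q(α) = β²`, a Cassini ball avoiding the real axis has `R ≤ β`, so this range of convergence
covers every admissible ball. Uniqueness (`sphericalCoeffs_unique`) comes from restricting to points
where `Δ_q` takes small real values `t` and comparing power series in `t`. -/

/-! ### Imaginary units and complex slices -/

lemma mem_imUnits_iff {K : ℍ[ℝ]} :
    K ∈ imUnits ↔ K.re = 0 ∧ K.imI ^ 2 + K.imJ ^ 2 + K.imK ^ 2 = 1 := by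
  simp only [imUnits, Set.mem_ofPred_eq, sq, Quaternion.ext_iff, Quaternion.re_mul,
    Quaternion.imI_mul, Quaternion.imJ_mul, Quaternion.imK_mul, Quaternion.re_neg,
    Quaternion.imI_neg, Quaternion.imJ_neg, Quaternion.imK_neg, Quaternion.re_one,
    Quaternion.imI_one, Quaternion.imJ_one, Quaternion.imK_one, neg_zero]
  constructor
  · rintro ⟨h0, h1, h2, h3⟩
    have hre : K.re = 0 := by
      by_contra hne
      have h1' : K.imI = 0 := by
        have : K.re * K.imI = 0 := by linarith
        simpa [hne] using this
      have h2' : K.imJ = 0 := by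
        have : K.re * K.imJ = 0 := by linarith
        simpa [hne] using this
      have h3' : K.imK = 0 := by
        have : K.re * K.imK = 0 := by linarith
        simpa [hne] using this
      rw [h1', h2', h3'] at h0
      nlinarith [mul_self_nonneg K.re]
    refine ⟨hre, ?_⟩
    rw [hre] at h0
    linarith
  · rintro ⟨h0, h1⟩
    rw [h0]
    refine ⟨by linarith, by ring, by ring, by ring⟩

lemma mul_self_of_mem_imUnits {K : ℍ[ℝ]} (hK : K ∈ imUnits) : K * K = -1 := by
  rw [← sq]
  exact hK

lemma mem_nonReal_iff {x : ℍ[ℝ]} : x ∈ nonReal ↔ x.im ≠ 0 := by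
  simp only [nonReal, Set.mem_ofPred_eq, Set.mem_range, ne_eq, not_iff_not]
  constructor
  · rintro ⟨r, rfl⟩
    simp
  · intro h
    refine ⟨x.re, ?_⟩
    conv_rhs => rw [← Quaternion.re_add_im x, h, add_zero]

/-- The real algebra embedding of `ℂ` onto the slice `ℝ + Kℝ`. -/
noncomputable def sliceHom (K : ℍ[ℝ]) (hK : K ∈ imUnits) : ℂ →ₐ[ℝ] ℍ[ℝ] :=
  Complex.liftAux K (mul_self_of_mem_imUnits hK)

lemma sliceHom_apply {K : ℍ[ℝ]} (hK : K ∈ imUnits) (z : ℂ) :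
    sliceHom K hK z = (z.re : ℍ[ℝ]) + K * (z.im : ℍ[ℝ]) := by
  rw [sliceHom, Complex.liftAux_apply, ← Quaternion.coe_mul_eq_smul, Quaternion.coe_commutes]
  rfl

lemma sliceHom_ofReal {K : ℍ[ℝ]} (hK : K ∈ imUnits) (r : ℝ) :
    sliceHom K hK (r : ℂ) = (r : ℍ[ℝ]) := by
  simp

lemma norm_sliceHom {K : ℍ[ℝ]} (hK : K ∈ imUnits) (z : ℂ) : ‖sliceHom K hK z‖ = ‖z‖ := by
  obtain ⟨h0, h1⟩ := mem_imUnits_iff.1 hK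
  have h : ‖sliceHom K hK z‖ ^ 2 = ‖z‖ ^ 2 := by
    rw [sq, ← Quaternion.normSq_eq_norm_mul_self, Quaternion.normSq_def', Complex.sq_norm,
      Complex.normSq_apply, sliceHom_apply]
    simp only [Quaternion.re_add, Quaternion.imI_add, Quaternion.imJ_add, Quaternion.imK_add,
      Quaternion.re_mul, Quaternion.imI_mul, Quaternion.imJ_mul, Quaternion.imK_mul,
      Quaternion.re_coe, Quaternion.imI_coe, Quaternion.imJ_coe, Quaternion.imK_coe, h0]
    linear_combination z.im ^ 2 * h1
  exact (sq_eq_sq₀ (norm_nonneg _) (norm_nonneg _)).1 h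

lemma norm_of_mem_imUnits {K : ℍ[ℝ]} (hK : K ∈ imUnits) : ‖K‖ = 1 := by
  have h := norm_sliceHom hK Complex.I
  simpa [sliceHom_apply] using h

lemma continuous_sliceHom {K : ℍ[ℝ]} (hK : K ∈ imUnits) : Continuous (sliceHom K hK) :=
  (sliceHom K hK).toLinearMap.continuous_of_finiteDimensional

lemma im_add_mul {K : ℍ[ℝ]} (hK : K ∈ imUnits) (a b : ℝ) :
    ((a : ℍ[ℝ]) + K * (b : ℍ[ℝ])).im = b • K := by
  obtain ⟨h0, -⟩ := mem_imUnits_iff.1 hK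
  ext <;> simp [h0, mul_comm]

lemma unitIm_add_mul {K : ℍ[ℝ]} (hK : K ∈ imUnits) (a b : ℝ) :
    unitIm ((a : ℍ[ℝ]) + K * (b : ℍ[ℝ])) = (|b|⁻¹ * b) • K := by
  rw [unitIm, im_add_mul hK, norm_smul, norm_of_mem_imUnits hK, mul_one, smul_smul,
    Real.norm_eq_abs]

lemma add_mul_mem_nonReal {K : ℍ[ℝ]} (hK : K ∈ imUnits) (a : ℝ) {b : ℝ} (hb : b ≠ 0) :
    (a : ℍ[ℝ]) + K * (b : ℍ[ℝ]) ∈ nonReal := by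
  rw [mem_nonReal_iff, im_add_mul hK, ← norm_ne_zero_iff, norm_smul, norm_of_mem_imUnits hK]
  simpa using hb

lemma exists_eq_add_mul {x : ℍ[ℝ]} (hx : x ∈ nonReal) :
    ∃ K ∈ imUnits, ∃ a b : ℝ, 0 < b ∧ x = (a : ℍ[ℝ]) + K * (b : ℍ[ℝ]) := by
  rw [mem_nonReal_iff] at hx
  have hb : 0 < ‖x.im‖ := norm_pos_iff.2 hx
  refine ⟨‖x.im‖⁻¹ • x.im, ?_, x.re, ‖x.im‖, hb, ?_⟩
  · change (‖x.im‖⁻¹ • x.im) ^ 2 = -1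
    rw [smul_pow, Quaternion.im_sq, Quaternion.normSq_eq_norm_mul_self, ← Quaternion.coe_neg,
      Quaternion.smul_coe, ← Quaternion.coe_one, ← Quaternion.coe_neg]
    congr 1
    field_simp
  · rw [← Quaternion.coe_commutes, Quaternion.coe_mul_eq_smul, smul_smul,
      mul_inv_cancel₀ hb.ne', one_smul, Quaternion.re_add_im]

/-! ### Slice regularity -/

lemma circularization_im_ne_zero : circularization {z : ℂ | z.im ≠ 0} = nonReal := by
  ext x
  constructor
  · rintro ⟨z, hz, K, hK, rfl⟩
    exact add_mul_mem_nonReal hK _ hz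
  · intro hx
    obtain ⟨K, hK, a, b, hb, rfl⟩ := exists_eq_add_mul hx
    exact ⟨⟨a, b⟩, hb.ne', K, hK, rfl⟩

/-- The sign of `Im z` is locally constant off the real axis. The stem function of `ellPlus J` is
therefore locally constant, and the Cauchy-Riemann equations are trivial. -/
lemma eventually_abs_inv_mul_eq {z : ℂ} (hz : z.im ≠ 0) :
    ∀ᶠ w in 𝓝 z, |w.im|⁻¹ * w.im = |z.im|⁻¹ * z.im := by
  rcases lt_or_gt_of_ne hz with h | h
  · filter_upwards [(isOpen_Iio.preimage Complex.continuous_im).mem_nhds h] with w hw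
    rw [abs_of_neg h, abs_of_neg (show w.im < 0 from hw), inv_neg, inv_neg, neg_mul, neg_mul,
      inv_mul_cancel₀ h.ne, inv_mul_cancel₀ (show w.im < 0 from hw).ne]
  · filter_upwards [(isOpen_Ioi.preimage Complex.continuous_im).mem_nhds h] with w hw
    rw [abs_of_pos h, abs_of_pos (show 0 < w.im from hw),
      inv_mul_cancel₀ h.ne', inv_mul_cancel₀ (show 0 < w.im from hw).ne']

theorem isSliceRegularOn_ellPlus (J : ℍ[ℝ]) : IsSliceRegularOn nonReal (ellPlus J) := by
  refine ⟨{z : ℂ | z.im ≠ 0}, isOpen_ne.preimage Complex.continuous_im, fun z => by simp,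
    circularization_im_ne_zero.symm, fun _ => (1 / 2 : ℝ) • 1,
    fun z => -((1 / 2 : ℝ) • (|z.im|⁻¹ * z.im) • J), ?_, ?_, ?_⟩
  · intro z _
    simp
  · intro z hz
    have h : (fun z : ℂ => -((1 / 2 : ℝ) • (|z.im|⁻¹ * z.im) • J)) =ᶠ[𝓝 z]
        fun _ => -((1 / 2 : ℝ) • (|z.im|⁻¹ * z.im) • J) := by
      filter_upwards [eventually_abs_inv_mul_eq hz] with w hw
      rw [hw]
    refine ⟨differentiableAt_const _, (differentiableAt_const _).congr_of_eventuallyEq h, ?_⟩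
    rw [h.fderiv_eq]
    simp
  · intro z _ K hK
    rw [ellPlus, unitIm_add_mul hK, smul_sub, smul_mul_assoc, mul_neg, mul_smul_comm,
      mul_smul_comm, sub_eq_add_neg]

/-! ### The characteristic polynomial on a slice -/

lemma charPoly_add_mul {I : ℍ[ℝ]} (hI : I ∈ imUnits) (α β : ℝ) (x : ℍ[ℝ]) :
    charPoly ((α : ℍ[ℝ]) + I * (β : ℍ[ℝ])) x =
      (x - (α : ℍ[ℝ])) ^ 2 + ((β ^ 2 : ℝ) : ℍ[ℝ]) := by
  obtain ⟨h0, h1⟩ := mem_imUnits_iff.1 hI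
  rw [charPoly]
  ext <;> simp [sq, h0]
  · linear_combination β ^ 2 * h1
  all_goals ring

lemma charPoly_sliceHom {I K : ℍ[ℝ]} (hI : I ∈ imUnits) (hK : K ∈ imUnits) (α β : ℝ) (z : ℂ) :
    charPoly ((α : ℍ[ℝ]) + I * (β : ℍ[ℝ])) (sliceHom K hK z) =
      sliceHom K hK ((z - α) ^ 2 + (β : ℂ) ^ 2) := by
  rw [charPoly_add_mul hI, ← sliceHom_ofReal hK, ← sliceHom_ofReal hK, ← map_sub, ← map_pow,
    ← map_add]
  push_cast
  rfl

/-! ### The binomial series of `(1 - u)^(-1/2)` -/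

lemma coeffConst_zero : coeffConst 0 = 1 / 2 := by
  simp [coeffConst]

lemma coeffConst_succ (n : ℕ) :
    (n + 1) * coeffConst (n + 1) = (1 / 2 + n) * coeffConst n := by
  -- At `n = 0` the truncated `2 * n - 1` is `0`, and `0‼ = 1` realizes the convention `(-1)!! = 1`.
  have h : (2 * (n + 1) - 1)‼ = (2 * n + 1) * (2 * n - 1)‼ := by
    rw [← Nat.doubleFactorial_add_one]
    rfl
  have hn : ((n + 1 : ℕ) : ℝ) ≠ 0 := by positivity
  have hf : (n ! : ℝ) ≠ 0 := by positivity
  rw [coeffConst, coeffConst, h, Nat.factorial_succ]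
  push_cast at hn ⊢
  field_simp
  ring

/-- Multiplied by `n!`, the left side is the rising factorial of `1/2`, whose recursion is that of
`coeffConst_succ`. -/
lemma choose_half (n : ℕ) :
    Ring.choose ((1 / 2 : ℂ) + n - 1) n = ((2 * coeffConst n : ℝ) : ℂ) := by
  have hf : (n ! : ℂ) ≠ 0 := by exact_mod_cast n.factorial_ne_zero
  apply mul_left_cancel₀ hf
  rw [← Ring.multichoose_eq, ← nsmul_eq_mul, Ring.factorial_nsmul_multichoose_eq_ascPochhammer,
    Polynomial.ascPochhammer_smeval_eq_eval]
  induction n with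
  | zero => simp [coeffConst_zero]
  | succ n ih =>
    rw [ascPochhammer_succ_eval, ih (by exact_mod_cast n.factorial_ne_zero), Nat.factorial_succ]
    have h := congrArg (fun r : ℝ => (r : ℂ)) (coeffConst_succ n)
    push_cast at h ⊢
    linear_combination (-2 * (n ! : ℂ)) * h

/-- The binomial series of `(1 - u)^(-1/2)`, in terms of a square root `w` of `1 - u`. -/
lemma hasSum_inv_sqrt {u w : ℂ} (hu : ‖u‖ < 1) (hw : 0 < w.re) (h : w ^ 2 = 1 - u) :
    HasSum (fun n : ℕ => ((2 * coeffConst n : ℝ) : ℂ) * u ^ n) w⁻¹ := by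
  have hs := (Complex.one_div_one_sub_cpow_hasFPowerSeriesOnBall_zero (1 / 2)).hasSum (y := u)
    (by simpa [enorm_eq_nnnorm, ← NNReal.coe_lt_coe] using hu)
  -- `0 < w.re` makes `w` the principal square root of `w ^ 2`.
  have hr : 1 / (1 - (0 + u)) ^ (1 / 2 : ℂ) = w⁻¹ := by
    rw [zero_add, ← h, one_div, one_div, Complex.sq_cpow_two_inv hw]
  rw [hr] at hs
  have hf : (fun n : ℕ => ((2 * coeffConst n : ℝ) : ℂ) * u ^ n) = fun n : ℕ =>
      FormalMultilinearSeries.ofScalars ℂ (fun n : ℕ => Ring.choose ((1 / 2 : ℂ) + n - 1) n) n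
        fun _ => u := by
    funext n
    rw [FormalMultilinearSeries.ofScalars_apply_eq, choose_half, smul_eq_mul]
  rw [hf]
  exact hs

/-! ### The spherical expansion -/

lemma hasSum_of_eq {E : Type*} [AddCommMonoid E] [TopologicalSpace E] {f g : ℕ → E} {a : E}
    (hf : HasSum f a) (h : ∀ n, g n = f n) : HasSum g a := by
  rwa [funext h]

/-- The spherical coefficients of `ellPlus J` at `α + Iβ`. -/
noncomputable def ellPlusCoeff (J I : ℍ[ℝ]) (β : ℝ) (n : ℕ) : ℍ[ℝ] :=
  (if n = 0 then (1 / 2 : ℝ) • 1 else 0) -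
    (coeffConst (n / 2) * (1 / β ^ n)) • (if Even n then I * J else J)

lemma ellPlusCoeff_zero (J I : ℍ[ℝ]) (β : ℝ) :
    ellPlusCoeff J I β 0 = (1 / 2 : ℝ) • (1 - I * J) := by
  simp [ellPlusCoeff, coeffConst_zero, smul_sub]

lemma ellPlusCoeff_two_mul (J I : ℍ[ℝ]) (β : ℝ) (k : ℕ) :
    ellPlusCoeff J I β (2 * k) = (if k = 0 then (1 / 2 : ℝ) • 1 else 0) -
      (coeffConst k * (1 / β ^ (2 * k))) • (I * J) := by
  simp [ellPlusCoeff]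

lemma ellPlusCoeff_two_mul_add_one (J I : ℍ[ℝ]) (β : ℝ) (k : ℕ) :
    ellPlusCoeff J I β (2 * k + 1) = -((coeffConst k * (1 / β ^ (2 * k + 1))) • J) := by
  have h : (2 * k + 1) / 2 = k := by omega
  simp [ellPlusCoeff, h]

lemma eq_ellPlusCoeff_iff {J I : ℍ[ℝ]} {β : ℝ} {s : ℕ → ℍ[ℝ]} :
    s = ellPlusCoeff J I β ↔ s 0 = (1 / 2 : ℝ) • (1 - I * J) ∧
      (∀ k : ℕ, 1 ≤ k → s (2 * k) = -((coeffConst k * (1 / β ^ (2 * k))) • (I * J))) ∧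
      (∀ k : ℕ, s (2 * k + 1) = -((coeffConst k * (1 / β ^ (2 * k + 1))) • J)) := by
  have heven (k : ℕ) (hk : 1 ≤ k) : ellPlusCoeff J I β (2 * k) =
      -((coeffConst k * (1 / β ^ (2 * k))) • (I * J)) := by
    rw [ellPlusCoeff_two_mul, if_neg (by omega), zero_sub]
  constructor
  · rintro rfl
    exact ⟨ellPlusCoeff_zero J I β, heven, ellPlusCoeff_two_mul_add_one J I β⟩
  · rintro ⟨h0, h1, h2⟩
    funext n
    obtain ⟨k, rfl | rfl⟩ := n.even_or_odd'
    · rcases Nat.eq_zero_or_pos k with rfl | hk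
      · rw [mul_zero, h0, ellPlusCoeff_zero]
      · rw [h1 k hk, heven k hk]
    · rw [h2, ellPlusCoeff_two_mul_add_one]

/-- The expansion of the imaginary unit `K` at a point `z` of the upper half plane. -/
lemma hasSum_unit {I K : ℍ[ℝ]} (hI : I ∈ imUnits) (hK : K ∈ imUnits) {α β : ℝ} (hβ : 0 < β)
    {z : ℂ} (hz : 0 < z.im)
    (hx : ‖charPoly ((α : ℍ[ℝ]) + I * (β : ℍ[ℝ])) (sliceHom K hK z)‖ < β ^ 2) :
    HasSum (fun n : ℕ => (2 * coeffConst n * (1 / β ^ (2 * n + 1))) •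
      (charPoly ((α : ℍ[ℝ]) + I * (β : ℍ[ℝ])) (sliceHom K hK z) ^ n *
        (sliceHom K hK z - (α : ℍ[ℝ])))) K := by
  have hβ' : (β : ℂ) ≠ 0 := by exact_mod_cast hβ.ne'
  rw [charPoly_sliceHom hI hK] at hx ⊢
  rw [norm_sliceHom] at hx
  set v : ℂ := (z - α) ^ 2 + (β : ℂ) ^ 2 with hv
  have hu : ‖v / (β : ℂ) ^ 2‖ < 1 := by
    rw [norm_div, norm_pow, Complex.norm_real, Real.norm_eq_abs, sq_abs]
    exact (div_lt_one (by positivity)).2 hx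
  -- The real part is `Im z / β`; this is where the upper half plane selects the branch of the root.
  have hw : 0 < ((-Complex.I * (z - α)) / (β : ℂ)).re := by
    rw [Complex.div_ofReal_re]
    refine div_pos ?_ hβ
    simpa using hz
  have hsq : ((-Complex.I * (z - α)) / (β : ℂ)) ^ 2 = 1 - v / (β : ℂ) ^ 2 := by
    rw [hv]
    field_simp
    linear_combination (z - α) ^ 2 * Complex.I_sq
  have hzα : z - α ≠ 0 := fun h => by simp [h] at hw
  have hs := ((hasSum_inv_sqrt hu hw hsq).mul_right ((z - α) / β)).map
    (sliceHom K hK).toLinearMap (continuous_sliceHom hK)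
  have hlim : ((-Complex.I * (z - α)) / (β : ℂ))⁻¹ * ((z - α) / β) = Complex.I := by
    field_simp
    linear_combination -Complex.I_sq
  rw [hlim] at hs
  convert hs using 1
  · funext n
    have : ((2 * coeffConst n : ℝ) : ℂ) * (v / (β : ℂ) ^ 2) ^ n * ((z - α) / β) =
        ((2 * coeffConst n * (1 / β ^ (2 * n + 1)) : ℝ) : ℂ) * (v ^ n * (z - α)) := by
      push_cast
      rw [div_pow, ← pow_mul, pow_succ]
      field_simp
    simp only [Function.comp_apply, this]
    rw [AlgHom.toLinearMap_apply, ← Complex.real_smul, map_smul, map_mul, map_pow, map_sub,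
      sliceHom_ofReal]
  · simp [sliceHom_apply]

/-- In the series for `K`, the summand `Iβ` of `x - α = Iβ + (x - q)` feeds the even coefficients,
its `β` lowering `β^-(2n+1)` to `β^-(2n)`; the summand `x - q` feeds the odd ones. -/
theorem hasSphericalExpansionOn_ellPlus (J : ℍ[ℝ]) {I : ℍ[ℝ]} (hI : I ∈ imUnits) (α : ℝ) {β R : ℝ}
    (hβ : 0 < β) (hR : R ^ 2 ≤ β ^ 2)
    (hsub : cassiniBall ((α : ℍ[ℝ]) + I * (β : ℍ[ℝ])) R ⊆ nonReal) :
    HasSphericalExpansionOn (cassiniBall ((α : ℍ[ℝ]) + I * (β : ℍ[ℝ])) R) (ellPlus J)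
      ((α : ℍ[ℝ]) + I * (β : ℍ[ℝ])) (ellPlusCoeff J I β) := by
  intro x hx
  obtain ⟨K, hK, a, b, hb, rfl⟩ := exists_eq_add_mul (hsub hx)
  have hval : ellPlus J ((a : ℍ[ℝ]) + K * (b : ℍ[ℝ])) =
      (1 / 2 : ℝ) • 1 - (1 / 2 : ℝ) • (K * J) := by
    rw [ellPlus, unitIm_add_mul hK, abs_of_pos hb, inv_mul_cancel₀ hb.ne', one_smul, smul_sub]
  have hs := hasSum_unit hI hK (α := α) hβ (z := ⟨a, b⟩) hb
    (by rw [sliceHom_apply]; exact lt_of_lt_of_le hx hR)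
  rw [sliceHom_apply] at hs
  rw [hval]
  generalize (a : ℍ[ℝ]) + K * (b : ℍ[ℝ]) = x at hs ⊢
  generalize hΔ : charPoly ((α : ℍ[ℝ]) + I * (β : ℍ[ℝ])) x = Δ at hs ⊢
  -- The constant `1/2` enters as a series supported at `n = 0`, which is why `s₀` is exceptional.
  have h0 := hasSum_ite_eq 0 ((1 / 2 : ℝ) • (1 : ℍ[ℝ]))
  refine hasSum_of_eq (h0.sub ((hs.mul_right J).const_smul (1 / 2 : ℝ))) fun n => ?_
  rw [ellPlusCoeff_two_mul, ellPlusCoeff_two_mul_add_one]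
  have hterm : coeffConst n * (1 / β ^ (2 * n)) =
      (coeffConst n * (1 / β ^ (2 * n + 1))) * β := by
    rw [pow_succ]
    field_simp
  have hite : Δ ^ n * (if n = 0 then (1 / 2 : ℝ) • (1 : ℍ[ℝ]) else 0) =
      if n = 0 then (1 / 2 : ℝ) • 1 else 0 := by
    split_ifs with h
    · simp [h]
    · simp
  have hc : 1 / 2 * (2 * coeffConst n * (1 / β ^ (2 * n + 1))) =
      coeffConst n * (1 / β ^ (2 * n + 1)) := by ring
  rw [hterm, smul_mul_assoc, smul_smul, hc, mul_add, mul_sub, hite]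
  generalize coeffConst n * (1 / β ^ (2 * n + 1)) = c
  have hsplit : (x - (α : ℍ[ℝ])) * J =
      β • (I * J) + (x - ((α : ℍ[ℝ]) + I * (β : ℍ[ℝ]))) * J := by
    rw [← smul_mul_assoc, ← Quaternion.coe_mul_eq_smul, Quaternion.coe_commutes]
    noncomm_ring
  rw [mul_assoc, hsplit, mul_smul, mul_neg, mul_neg, mul_smul_comm, mul_smul_comm, mul_smul_comm,
    mul_add, mul_smul_comm β, mul_smul_comm c, smul_add]
  abel

/-! ### Admissible radii and uniqueness of the coefficients -/

/-- Cassini balls around `α + Iβ` that avoid the real axis have radius at most `β`. -/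
lemma sq_le_sq_of_cassiniBall_subset {I : ℍ[ℝ]} (hI : I ∈ imUnits) {α β R : ℝ}
    (hsub : cassiniBall ((α : ℍ[ℝ]) + I * (β : ℍ[ℝ])) R ⊆ nonReal) : R ^ 2 ≤ β ^ 2 := by
  by_contra! h
  have hmem : (α : ℍ[ℝ]) ∈ cassiniBall ((α : ℍ[ℝ]) + I * (β : ℍ[ℝ])) R := by
    change ‖charPoly _ _‖ < R ^ 2
    rw [charPoly_add_mul hI, sub_self, zero_pow two_ne_zero, zero_add, Quaternion.norm_coe,
      Real.norm_eq_abs, abs_of_nonneg (sq_nonneg β)]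
    exact h
  exact hsub hmem ⟨α, rfl⟩

lemma cassiniBall_self_subset_nonReal {I : ℍ[ℝ]} (hI : I ∈ imUnits) (α β : ℝ) :
    cassiniBall ((α : ℍ[ℝ]) + I * (β : ℍ[ℝ])) β ⊆ nonReal := by
  rintro _ hx ⟨r, rfl⟩
  change ‖charPoly _ _‖ < β ^ 2 at hx
  rw [charPoly_add_mul hI, ← Quaternion.coe_sub, ← Quaternion.coe_pow, ← Quaternion.coe_add,
    Quaternion.norm_coe, Real.norm_eq_abs] at hx
  nlinarith [le_abs_self ((r - α) ^ 2 + β ^ 2), sq_nonneg (r - α)]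

/-- A power series in a small real variable that vanishes identically has zero coefficients. -/
lemma eq_zero_of_eventually_hasSum_zero {E : Type*} [NormedAddCommGroup E] [NormedSpace ℝ E]
    {a : ℕ → E} (h : ∀ᶠ t : ℝ in 𝓝 0, HasSum (fun n => t ^ n • a n) 0) (n : ℕ) : a n = 0 := by
  let p : FormalMultilinearSeries ℝ ℝ E :=
    fun n => ContinuousMultilinearMap.mkPiRing ℝ (Fin n) (a n)
  have hcoeff (n : ℕ) : p.coeff n = a n := by
    simp [p, FormalMultilinearSeries.coeff]
  have hp : HasFPowerSeriesAt (0 : ℝ → E) p 0 := by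
    rw [hasFPowerSeriesAt_iff]
    simpa [hcoeff] using h
  rw [← hcoeff, hp.eq_zero]
  simp [FormalMultilinearSeries.coeff]

/-- The spherical coefficients of a function at a non-real point are unique. -/
theorem sphericalCoeffs_unique {f : ℍ[ℝ] → ℍ[ℝ]} {I : ℍ[ℝ]} (hI : I ∈ imUnits) {α β R R' : ℝ}
    (hβ : 0 < β) (hR : 0 < R) (hR' : 0 < R') {s s' : ℕ → ℍ[ℝ]}
    (h : HasSphericalExpansionOn (cassiniBall ((α : ℍ[ℝ]) + I * (β : ℍ[ℝ])) R) f
      ((α : ℍ[ℝ]) + I * (β : ℍ[ℝ])) s)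
    (h' : HasSphericalExpansionOn (cassiniBall ((α : ℍ[ℝ]) + I * (β : ℍ[ℝ])) R') f
      ((α : ℍ[ℝ]) + I * (β : ℍ[ℝ])) s') : s = s' := by
  set q : ℍ[ℝ] := (α : ℍ[ℝ]) + I * (β : ℍ[ℝ]) with hq
  -- A real value `t` of `Δ_q` is central, so its powers act as scalars.
  have hsum {t : ℝ} (h1 : |t| < R ^ 2) (h2 : |t| < R' ^ 2) {x : ℍ[ℝ]} (hx : charPoly q x = t) :
      HasSum (fun n => t ^ n • ((s (2 * n) - s' (2 * n)) +
        (x - q) * (s (2 * n + 1) - s' (2 * n + 1)))) 0 := by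
    have hm : x ∈ cassiniBall q R := by
      change ‖charPoly q x‖ < R ^ 2
      rwa [hx, Quaternion.norm_coe]
    have hm' : x ∈ cassiniBall q R' := by
      change ‖charPoly q x‖ < R' ^ 2
      rwa [hx, Quaternion.norm_coe]
    have hd := (h x hm).sub (h' x hm')
    rw [sub_self] at hd
    refine hasSum_of_eq hd fun n => ?_
    rw [hx, ← Quaternion.coe_pow, Quaternion.coe_mul_eq_smul, Quaternion.coe_mul_eq_smul,
      ← smul_sub]
    congr 1
    noncomm_ring
  -- `Δ_q(α ± y) = y² + β²`, so `y = √(β² - t) I` works.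
  have hroot {t : ℝ} (ht : t < β ^ 2) : ∃ y : ℍ[ℝ], y ≠ 0 ∧ charPoly q ((α : ℍ[ℝ]) + y) = t ∧
      charPoly q ((α : ℍ[ℝ]) - y) = t := by
    have hpos : 0 < β ^ 2 - t := sub_pos.2 ht
    have hy : (√(β ^ 2 - t) • I) ^ 2 = ((t - β ^ 2 : ℝ) : ℍ[ℝ]) := by
      rw [smul_pow, Real.sq_sqrt hpos.le, hI, smul_neg, ← neg_smul, neg_sub,
        ← Quaternion.coe_one, Quaternion.smul_coe, mul_one]
    refine ⟨√(β ^ 2 - t) • I, ?_, ?_, ?_⟩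
    · rw [← norm_ne_zero_iff, norm_smul, norm_of_mem_imUnits hI, mul_one]
      exact norm_ne_zero_iff.2 (Real.sqrt_pos.2 hpos).ne'
    · rw [hq, charPoly_add_mul hI, add_sub_cancel_left, hy, ← Quaternion.coe_add, sub_add_cancel]
    · rw [hq, charPoly_add_mul hI, sub_sub_cancel_left, neg_sq, hy, ← Quaternion.coe_add,
        sub_add_cancel]
  have hsmall : ∀ᶠ t : ℝ in 𝓝 0, |t| < R ^ 2 ∧ |t| < R' ^ 2 ∧ t < β ^ 2 := by
    have habs : Tendsto (fun t : ℝ => |t|) (𝓝 0) (𝓝 0) := by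
      simpa using (continuous_abs (G := ℝ)).tendsto 0
    exact (habs.eventually_lt_const (by positivity)).and
      ((habs.eventually_lt_const (by positivity)).and
        (tendsto_id.eventually_lt_const (by positivity)))
  -- The points `α ± y` share the value `t`; subtracting their series cancels the even coefficients
  -- and leaves the odd ones multiplied on the left by `2y`, which is invertible.
  have hodd (n : ℕ) : s (2 * n + 1) - s' (2 * n + 1) = 0 := by
    refine eq_zero_of_eventually_hasSum_zero
      (a := fun n => s (2 * n + 1) - s' (2 * n + 1)) ?_ n
    filter_upwards [hsmall] with t ⟨h1, h2, h3⟩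
    obtain ⟨y, hy, hp, hm⟩ := hroot h3
    have hd := ((hsum h1 h2 hp).sub (hsum h1 h2 hm)).mul_left ((2 : ℝ) • y)⁻¹
    rw [sub_zero, mul_zero] at hd
    refine hasSum_of_eq hd fun n => ?_
    have h2y : (2 : ℝ) • y ≠ 0 := smul_ne_zero two_ne_zero hy
    rw [← smul_sub, mul_smul_comm]
    congr 1
    rw [eq_inv_mul_iff_mul_eq₀ h2y, two_smul]
    noncomm_ring
  have heven (n : ℕ) : s (2 * n) - s' (2 * n) = 0 := by
    refine eq_zero_of_eventually_hasSum_zero (a := fun n => s (2 * n) - s' (2 * n)) ?_ n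
    filter_upwards [hsmall] with t ⟨h1, h2, h3⟩
    obtain ⟨y, -, hp, -⟩ := hroot h3
    simpa [hodd] using hsum h1 h2 hp
  funext n
  obtain ⟨k, rfl | rfl⟩ := n.even_or_odd'
  · exact sub_eq_zero.1 (heven k)
  · exact sub_eq_zero.1 (hodd k)

/-! ### Conclusion -/

theorem isSphericalCoeffs_ellPlus_iff (J : ℍ[ℝ]) {I : ℍ[ℝ]} (hI : I ∈ imUnits) (α : ℝ) {β : ℝ}
    (hβ : 0 < β) (s : ℕ → ℍ[ℝ]) :
    IsSphericalCoeffs nonReal (ellPlus J) ((α : ℍ[ℝ]) + I * (β : ℍ[ℝ])) s ↔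
      s = ellPlusCoeff J I β := by
  have hsub := cassiniBall_self_subset_nonReal hI α β
  have hexp := hasSphericalExpansionOn_ellPlus J hI α hβ le_rfl hsub
  have hq := add_mul_mem_nonReal hI α hβ.ne'
  constructor
  · rintro ⟨-, -, R, hR, -, h⟩
    exact sphericalCoeffs_unique hI hβ hR hβ h hexp
  · rintro rfl
    exact ⟨isSliceRegularOn_ellPlus J, ⟨hq, hq⟩, β, hβ, hsub, hexp⟩

/-- Reduces every claim about `ℓ^{-,J}` to the one about `ℓ^{+,-J}`. -/
lemma ellMinus_eq_ellPlus_neg (J : ℍ[ℝ]) : ellMinus J = ellPlus (-J) := by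
  funext x
  rw [ellMinus, ellPlus, mul_neg, sub_neg_eq_add]

end SliceReg

theorem corollary4p5 (J I : ℍ[ℝ]) (hJ : J ∈ SliceReg.imUnits) (hI : I ∈ SliceReg.imUnits)
    (α β : ℝ) (hβ : 0 < β) (q : ℍ[ℝ]) (hq : q = (α : ℍ[ℝ]) + I * (β : ℍ[ℝ])) :
    -- the spherical coefficients of `ℓ^{+,J}` at `q` exist, are unique, and are the following
    (∀ s : ℕ → ℍ[ℝ], SliceReg.IsSphericalCoeffs SliceReg.nonReal (SliceReg.ellPlus J) q s ↔
      s 0 = (1 / 2 : ℝ) • (1 - I * J) ∧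
      (∀ k : ℕ, 1 ≤ k → s (2 * k) = -((SliceReg.coeffConst k * (1 / β ^ (2 * k))) • (I * J))) ∧
      (∀ k : ℕ, s (2 * k + 1) = -((SliceReg.coeffConst k * (1 / β ^ (2 * k + 1))) • J))) ∧
    -- the spherical coefficients of `ℓ^{-,J}` at `q` exist, are unique, and are the following
    (∀ s : ℕ → ℍ[ℝ], SliceReg.IsSphericalCoeffs SliceReg.nonReal (SliceReg.ellMinus J) q s ↔
      s 0 = (1 / 2 : ℝ) • (1 + I * J) ∧
      (∀ k : ℕ, 1 ≤ k → s (2 * k) = (SliceReg.coeffConst k * (1 / β ^ (2 * k))) • (I * J)) ∧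
      (∀ k : ℕ, s (2 * k + 1) = (SliceReg.coeffConst k * (1 / β ^ (2 * k + 1))) • J)) ∧
    -- the expansions are valid on every Cassini ball around `q` contained in `ℍ ∖ ℝ`
    (∀ R : ℝ, 0 < R → SliceReg.cassiniBall q R ⊆ SliceReg.nonReal → ∀ s : ℕ → ℍ[ℝ],
      (SliceReg.IsSphericalCoeffs SliceReg.nonReal (SliceReg.ellPlus J) q s →
        SliceReg.HasSphericalExpansionOn (SliceReg.cassiniBall q R) (SliceReg.ellPlus J) q s) ∧
      (SliceReg.IsSphericalCoeffs SliceReg.nonReal (SliceReg.ellMinus J) q s →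
        SliceReg.HasSphericalExpansionOn (SliceReg.cassiniBall q R) (SliceReg.ellMinus J) q s)) := by
  subst hq
  rw [SliceReg.ellMinus_eq_ellPlus_neg]
  refine ⟨fun s => ?_, fun s => ?_, fun R _ hsub s => ?_⟩
  · rw [SliceReg.isSphericalCoeffs_ellPlus_iff J hI α hβ, SliceReg.eq_ellPlusCoeff_iff]
  · rw [SliceReg.isSphericalCoeffs_ellPlus_iff (-J) hI α hβ, SliceReg.eq_ellPlusCoeff_iff]
    simp only [mul_neg, sub_neg_eq_add, smul_neg, neg_neg]
  · have hR := SliceReg.sq_le_sq_of_cassiniBall_subset hI hsub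
    rw [SliceReg.isSphericalCoeffs_ellPlus_iff J hI α hβ,
      SliceReg.isSphericalCoeffs_ellPlus_iff (-J) hI α hβ]
    constructor <;> rintro rfl <;>
      exact SliceReg.hasSphericalExpansionOn_ellPlus _ hI α hβ hR hsub
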